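/- Let $P$ be a finite poset with $n$ elements. A permutation on $P$ is a bijection $\sigma\colon\{1,\dots,n\}\to P$, written as the list $(\sigma_1,\dots,\sigma_n)$. We say that $\sigma$ contains the pattern $123$ if there are positions $i<j<k$ with $\sigma_i<\sigma_j<\sigma_k$ in $P$, and that it contains the pattern $132$ if there are positions $i<j<k$ with $\sigma_i<\sigma_k<\sigma_j$ in $P$; otherwise $\sigma$ avoids the pattern. Let $Av_P(\pi)$ denote the number of permutations on $P$ that avoid the pattern $\pi$. **Theorem.** For every finite poset $P$, $$Av_P(132)\le Av_P(123).$$ The inequality is strict if and only if $P$ contains at least one of the following three posets on the five-element set $\{a,b,c,d,e\}$ as an induced subposet, where each poset is given by its covering relations: - $Q_1$: $d<a<c$ and $e<b<c$; - $Q_2$: $d<a<c$, $e<b<c$ and $e<a$; - $Q_3$: $e<d<a<c$ and $e<b<c$. (An induced subposet of $P$ isomorphic to $Q$ is the image of a map $f\colon Q\to P$ such that $x\le y$ if and only if $f(x)\le f(y)$.) -/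

import Mathlib

/-- The permutation `σ` (the list `σ 0, σ 1, …, σ (n - 1)` of all elements of the poset `P`)
contains the pattern `π` (a list of all elements of the poset `Q`): there are positions
`i 0 < i 1 < ⋯ < i (k - 1)` such that for all `s < t` the order relation (`<`, `>` or
incomparable) between `σ (i s)` and `σ (i t)` is the one between `π s` and `π t`.
Distinct entries of a permutation are distinct elements, so the relation is "incomparable"
exactly when it is neither `<` nor `>`. -/
def PosetPerm.Contains {P Q : Type*} [PartialOrder P] [PartialOrder Q] {n k : ℕ}
    (σ : Fin n ≃ P) (π : Fin k ≃ Q) : Prop :=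
  ∃ i : Fin k → Fin n, StrictMono i ∧ ∀ s t : Fin k, s < t →
    ((σ (i s) < σ (i t) ↔ π s < π t) ∧ (σ (i t) < σ (i s) ↔ π t < π s))

/-- `σ` avoids the pattern `π`. -/
def PosetPerm.Avoids {P Q : Type*} [PartialOrder P] [PartialOrder Q] {n k : ℕ}
    (σ : Fin n ≃ P) (π : Fin k ≃ Q) : Prop :=
  ¬ PosetPerm.Contains σ π

/-- `Av_P(π)`: the number of permutations on the finite poset `P`, that is, of bijections from
`{0, …, |P| - 1}` to `P`, that avoid the pattern `π`. -/
noncomputable def PosetPerm.Av (P : Type*) [PartialOrder P] {Q : Type*} [PartialOrder Q] {k : ℕ}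
    (π : Fin k ≃ Q) : ℕ :=
  Nat.card {σ : Fin (Nat.card P) ≃ P // PosetPerm.Avoids σ π}

/-- The pattern `123` on the three-element chain (with entries `0, 1, 2`). -/
def PosetPerm.pat123 : Fin 3 ≃ Fin 3 := Equiv.refl (Fin 3)

/-- The pattern `132` on the three-element chain (with entries `0, 2, 1`). -/
def PosetPerm.pat132 : Fin 3 ≃ Fin 3 := Equiv.swap 1 2

/-- The common underlying set of the three posets `Q₁`, `Q₂`, `Q₃`. -/
inductive PosetPerm.Five : Type
  | a | b | c | d | e
  deriving DecidableEq

instance PosetPerm.instFintypeFive : Fintype PosetPerm.Five where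
  elems := {.a, .b, .c, .d, .e}
  complete x := by cases x <;> decide

/-- The poset `Q₁`, with covering relations `d < a < c` and `e < b < c`. -/
def PosetPerm.Q₁ : Type := PosetPerm.Five

/-- The poset `Q₂`, with covering relations `d < a < c`, `e < b < c` and `e < a`. -/
def PosetPerm.Q₂ : Type := PosetPerm.Five

/-- The poset `Q₃`, with covering relations `e < d < a < c` and `e < b < c`. -/
def PosetPerm.Q₃ : Type := PosetPerm.Five

/-- The strict order of `Q₁`, pair by pair. -/
def PosetPerm.lt₁ : List (PosetPerm.Five × PosetPerm.Five) :=
  [(.d, .a), (.d, .c), (.a, .c), (.e, .b), (.e, .c), (.b, .c)]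

/-- The strict order of `Q₂`, pair by pair. -/
def PosetPerm.lt₂ : List (PosetPerm.Five × PosetPerm.Five) :=
  [(.d, .a), (.d, .c), (.a, .c), (.e, .b), (.e, .c), (.b, .c), (.e, .a)]

/-- The strict order of `Q₃`, pair by pair. -/
def PosetPerm.lt₃ : List (PosetPerm.Five × PosetPerm.Five) :=
  [(.d, .a), (.d, .c), (.a, .c), (.e, .b), (.e, .c), (.b, .c), (.e, .a), (.e, .d)]

instance PosetPerm.instPartialOrderQ₁ : PartialOrder PosetPerm.Q₁ where
  le (x y : PosetPerm.Five) := x = y ∨ (x, y) ∈ PosetPerm.lt₁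
  le_refl _ := Or.inl rfl
  le_trans := by
    have h : ∀ x y z : PosetPerm.Five, (x = y ∨ (x, y) ∈ PosetPerm.lt₁) →
        (y = z ∨ (y, z) ∈ PosetPerm.lt₁) → (x = z ∨ (x, z) ∈ PosetPerm.lt₁) := by decide
    exact h
  le_antisymm := by
    have h : ∀ x y : PosetPerm.Five, (x = y ∨ (x, y) ∈ PosetPerm.lt₁) →
        (y = x ∨ (y, x) ∈ PosetPerm.lt₁) → x = y := by decide
    exact h

instance PosetPerm.instPartialOrderQ₂ : PartialOrder PosetPerm.Q₂ where
  le (x y : PosetPerm.Five) := x = y ∨ (x, y) ∈ PosetPerm.lt₂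
  le_refl _ := Or.inl rfl
  le_trans := by
    have h : ∀ x y z : PosetPerm.Five, (x = y ∨ (x, y) ∈ PosetPerm.lt₂) →
        (y = z ∨ (y, z) ∈ PosetPerm.lt₂) → (x = z ∨ (x, z) ∈ PosetPerm.lt₂) := by decide
    exact h
  le_antisymm := by
    have h : ∀ x y : PosetPerm.Five, (x = y ∨ (x, y) ∈ PosetPerm.lt₂) →
        (y = x ∨ (y, x) ∈ PosetPerm.lt₂) → x = y := by decide
    exact h

instance PosetPerm.instPartialOrderQ₃ : PartialOrder PosetPerm.Q₃ where
  le (x y : PosetPerm.Five) := x = y ∨ (x, y) ∈ PosetPerm.lt₃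
  le_refl _ := Or.inl rfl
  le_trans := by
    have h : ∀ x y z : PosetPerm.Five, (x = y ∨ (x, y) ∈ PosetPerm.lt₃) →
        (y = z ∨ (y, z) ∈ PosetPerm.lt₃) → (x = z ∨ (x, z) ∈ PosetPerm.lt₃) := by decide
    exact h
  le_antisymm := by
    have h : ∀ x y : PosetPerm.Five, (x = y ∨ (x, y) ∈ PosetPerm.lt₃) →
        (y = x ∨ (y, x) ∈ PosetPerm.lt₃) → x = y := by decide
    exact h

/-- `P` contains `Q` as an induced subposet: some map `Q → P` preserves and reflects the order
(hence is injective). -/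
def PosetPerm.HasInduced (P Q : Type*) [PartialOrder P] [PartialOrder Q] : Prop :=
  Nonempty (Q ↪o P)

namespace PosetPerm

/-! Fix the left-to-right minima of `σ` (entries with no smaller entry before them) and their
positions. They alone determine `Released`, so they fix which elements may occupy each other
position. Then `σ` avoids 123 iff its remaining entries have no ascending pair
(`avoids_pat123_iff_topDown`), and avoids 132 iff each of them is minimal among the released entries
still to be placed (`avoids_pat132_iff_greedyMin`).

`rearrange` turns the second kind of filling into the first by sliding entries in from the right.
Each slide is undone by `slideOut`, which needs only the set released at that time, so the map is
injective and the inequality follows.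

The inverse slide can fail only when it carries `x` past an unreleased `w < x` and then exchanges it
with a released `v < x`, where `w < v` fails. With an element below `v` but not below `w`, and one
below `w`, this is `HasConfiguration`, equivalent to containing some `Qᵢ`. Conversely, a
configuration gives a 123-avoider whose non-minima are `c, b, a`, and no 132-avoider is sent to it.
-/

open Classical in
/-- Insert `x` in front of the list `l` and slide it down: reading `l` from right to left, the
carried entry is exchanged with every larger entry that is met.  The result is the final carried
entry together with the modified list. -/
noncomputable def slideIn {P : Type*} [PartialOrder P] (x : P) : List P → P × List P
  | [] => (x, [])
  | z :: l =>
    if (slideIn x l).1 < z then (z, (slideIn x l).1 :: (slideIn x l).2)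
    else ((slideIn x l).1, z :: (slideIn x l).2)

open Classical in
/-- The inverse slide: reading the list from left to right, the carried entry is exchanged with
every smaller entry satisfying `V` that is met. -/
noncomputable def slideOut {P : Type*} [PartialOrder P] (V : P → Prop) : P → List P → P × List P
  | y, [] => (y, [])
  | y, z :: l =>
    if z < y ∧ V z then ((slideOut V z l).1, y :: (slideOut V z l).2)
    else ((slideOut V y l).1, z :: (slideOut V y l).2)

/-- Slide in all entries of a list, from the last one to the first one. -/
noncomputable def rearrange {P : Type*} [PartialOrder P] : List P → List P
  | [] => []
  | a :: l => (slideIn a (rearrange l)).1 :: (slideIn a (rearrange l)).2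

/-- No entry of the list is smaller than a later one. -/
def TopDown {P : Type*} [PartialOrder P] (l : List P) : Prop :=
  l.Pairwise fun a b => ¬ a < b

/-- At time `t` the elements satisfying `U t` are released.  The list `l`, with entries placed at
the times `ts`, consists of released entries, each of them minimal among the released entries that
have not yet been placed. -/
inductive GreedyMin {P τ : Type*} [PartialOrder P] (U : τ → P → Prop) : List τ → List P → Prop
  | nil : GreedyMin U [] []
  | cons {t : τ} {ts : List τ} {a : P} {l : List P} (ha : U t a)
      (hmin : ∀ b ∈ l, U t b → ¬ b < a) (h : GreedyMin U ts l) : GreedyMin U (t :: ts) (a :: l)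

/-! ### Slides on lists and their inverses -/

section Lists

variable {P : Type*} [PartialOrder P]

theorem slideIn_perm (x : P) (l : List P) :
    ((slideIn x l).1 :: (slideIn x l).2).Perm (x :: l) := by
  induction l with
  | nil => simp [slideIn]
  | cons z l ih =>
    have h := (ih.cons z).trans (List.Perm.swap x z l)
    rw [slideIn]
    split_ifs
    · exact h
    · exact (List.Perm.swap _ _ _).trans h

theorem rearrange_perm (l : List P) : (rearrange l).Perm l := by
  induction l with
  | nil => simp [rearrange]
  | cons a l ih => exact (slideIn_perm a _).trans (ih.cons a)

theorem le_slideIn (x : P) (l : List P) : x ≤ (slideIn x l).1 := by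
  induction l with
  | nil => simp [slideIn]
  | cons z l ih =>
    rw [slideIn]
    split_ifs with h
    · exact ih.trans h.le
    · exact ih

/-- The carried entry only grows, so a new ascent would have to end at `x`. An entry above the
carried one takes over as head, and one below `x` cannot precede a larger carried entry of `l`. -/
theorem slideIn_topDown {x : P} {l : List P} (hl : TopDown l) (hn : (x :: l).Nodup) :
    TopDown ((slideIn x l).1 :: (slideIn x l).2) := by
  unfold TopDown at *
  induction l with
  | nil => simp [slideIn]
  | cons z l ih =>
    obtain ⟨hz, hl⟩ := List.pairwise_cons.1 hl
    have hn' : (x :: l).Nodup := by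
      simp only [List.nodup_cons, List.mem_cons, not_or] at hn ⊢
      exact ⟨hn.1.2, hn.2.2⟩
    have ih := ih hl hn'
    have hp := slideIn_perm x l
    have hle := le_slideIn x l
    have hnd := hp.nodup_iff.2 hn'
    rw [slideIn]
    generalize (slideIn x l).1 = c at *
    generalize (slideIn x l).2 = l' at *
    have hmem : ∀ u, u ∈ c :: l' → u = x ∨ u ∈ l := fun u hu => by
      simpa using hp.mem_iff.1 hu
    obtain ⟨hc, hl'⟩ := List.pairwise_cons.1 ih
    split_ifs with h
    · refine List.pairwise_cons.2 ⟨fun u hu hzu => ?_, ih⟩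
      rcases hmem u hu with rfl | hu
      · exact lt_irrefl _ (hzu.trans_le (hle.trans h.le))
      · exact hz u hu hzu
    · refine List.pairwise_cons.2 ⟨fun u hu => ?_, List.pairwise_cons.2 ⟨fun u hu hzu => ?_, hl'⟩⟩
      · rcases List.mem_cons.1 hu with rfl | hu
        · exact h
        · exact hc u hu
      · rcases hmem u (List.mem_cons_of_mem _ hu) with rfl | hu'
        · rcases hmem c List.mem_cons_self with rfl | hcl
          · exact (List.nodup_cons.1 hnd).1 hu
          · exact hz c hcl (hzu.trans_le hle)
        · exact hz u hu' hzu

theorem slideIn_released {τ : Type*} [Preorder τ] {U : τ → P → Prop}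
    (hmono : ∀ ⦃s t r⦄, s ≤ t → U s r → U t r) (hup : ∀ ⦃t r r'⦄, r < r' → U t r → U t r')
    {s : τ} {x : P} (hx : U s x) {ts : List τ} {l : List P} (hl : List.Forall₂ U ts l)
    (hs : ∀ t ∈ ts, s ≤ t) :
    U s (slideIn x l).1 ∧ List.Forall₂ U ts (slideIn x l).2 := by
  refine ⟨(le_slideIn x l).eq_or_lt.elim (fun h => h ▸ hx) fun h => hup h hx, ?_⟩
  induction hl with
  | nil => simp [slideIn]
  | @cons t z ts l hz hl ih =>
    have ih := ih fun t ht => hs t (List.mem_cons_of_mem _ ht)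
    rw [slideIn]
    split_ifs
    · refine .cons (hmono (hs t List.mem_cons_self) ?_) ih
      exact (le_slideIn x l).eq_or_lt.elim (fun h => h ▸ hx) fun h => hup h hx
    · exact .cons hz ih

/-- The comparison at each position reveals whether an exchange took place. A false positive would
be some `z` in `V` below the carried entry, which is `x` (excluded by minimality) or a later entry
of `l` (excluded by `TopDown`). -/
theorem slideOut_slideIn {V : P → Prop} (hup : ∀ ⦃r r'⦄, r < r' → V r → V r') {x : P} (hx : V x)
    {l : List P} (hl : TopDown l) (hmin : ∀ z ∈ l, V z → ¬ z < x) :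
    slideOut V (slideIn x l).1 (slideIn x l).2 = (x, l) := by
  induction l with
  | nil => simp [slideIn, slideOut]
  | cons z l ih =>
    obtain ⟨hz, hl⟩ := List.pairwise_cons.1 hl
    have ih := ih hl fun z hz => hmin z (List.mem_cons_of_mem _ hz)
    have hp := (slideIn_perm x l).mem_iff.1 (List.mem_cons_self (a := (slideIn x l).1))
    have hV : V (slideIn x l).1 :=
      (le_slideIn x l).eq_or_lt.elim (fun h => h ▸ hx) fun h => hup h hx
    rw [slideIn]
    split_ifs with h
    · rw [slideOut, if_pos ⟨h, hV⟩, ih]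
    · rw [slideOut, if_neg, ih]
      rintro ⟨hzc, hVz⟩
      rcases List.mem_cons.1 hp with hp | hp
      · exact hmin z List.mem_cons_self hVz (hp ▸ hzc)
      · exact hz _ hp hzc

theorem slideIn_slideOut {V : P → Prop} {y : P} {l : List P} (hl : TopDown (y :: l)) :
    slideIn (slideOut V y l).1 (slideOut V y l).2 = (y, l) := by
  unfold TopDown at hl
  induction l generalizing y with
  | nil => simp [slideIn, slideOut]
  | cons z l ih =>
    rw [slideOut]
    split_ifs with h
    · rw [slideIn, ih (List.pairwise_cons.1 hl).2, if_pos h.1]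
    · have hy : (y :: l).Pairwise fun a b => ¬ a < b :=
        hl.sublist ((List.sublist_cons_self z l).cons_cons y)
      rw [slideIn, ih hy, if_neg ((List.pairwise_cons.1 hl).1 z List.mem_cons_self)]

theorem slideOut_perm (V : P → Prop) (y : P) (l : List P) :
    ((slideOut V y l).1 :: (slideOut V y l).2).Perm (y :: l) := by
  induction l generalizing y with
  | nil => simp [slideOut]
  | cons z l ih =>
    rw [slideOut]
    split_ifs
    · exact (List.Perm.swap _ _ _).trans ((ih z).cons y)
    · exact (List.Perm.swap _ _ _).trans (((ih y).cons z).trans (List.Perm.swap _ _ _))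

theorem slideOut_le (V : P → Prop) (y : P) (l : List P) : (slideOut V y l).1 ≤ y := by
  induction l generalizing y with
  | nil => simp [slideOut]
  | cons z l ih =>
    rw [slideOut]
    split_ifs with h
    · exact (ih z).trans h.1.le
    · exact ih y

theorem slideOut_of_forall_not_lt {V : P → Prop} {y : P} {l : List P}
    (h : ∀ z ∈ l, V z → ¬ z < y) : slideOut V y l = (y, l) := by
  induction l with
  | nil => simp [slideOut]
  | cons z l ih =>
    rw [slideOut, if_neg fun hz => h z List.mem_cons_self hz.2 hz.1,
      ih fun z hz => h z (List.mem_cons_of_mem _ hz)]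

theorem slideOut_released {τ : Type*} [Preorder τ] {U : τ → P → Prop}
    (hmono : ∀ ⦃s t r⦄, s ≤ t → U s r → U t r)
    {s : τ} {y : P} (hy : U s y) {ts : List τ} {l : List P} (hl : List.Forall₂ U ts l)
    (hs : ∀ t ∈ ts, s ≤ t) :
    U s (slideOut (U s) y l).1 ∧ List.Forall₂ U ts (slideOut (U s) y l).2 := by
  induction hl generalizing y with
  | nil => simp [slideOut, hy]
  | @cons t z ts l hz hl ih =>
    have hs' := fun t ht => hs t (List.mem_cons_of_mem _ ht)
    rw [slideOut]
    split_ifs with h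
    · exact ⟨(ih h.2 hs').1, .cons (hmono (hs t List.mem_cons_self) hy) (ih h.2 hs').2⟩
    · exact ⟨(ih hy hs').1, .cons hz (ih hy hs').2⟩

/-- `hV` excludes the only obstruction: `x` jumps over `w`, which is not in `V`, and is then
deposited to its right, creating the ascent `w < x`. -/
theorem slideOut_topDown {V : P → Prop} {y : P} {l : List P} (hl : TopDown (y :: l)) (hy : V y)
    (hV : ∀ x ∈ y :: l, ∀ v ∈ y :: l, ∀ w ∈ y :: l, V x → V v → ¬ V w → w < x → v < x → w < v) :
    TopDown (slideOut V y l).2 ∧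
      ∀ z ∈ (slideOut V y l).2, V z → ¬ z < (slideOut V y l).1 := by
  unfold TopDown at *
  induction l generalizing y with
  | nil => simp [slideOut]
  | cons z l ih =>
    obtain ⟨hyl, hzl⟩ := List.pairwise_cons.1 hl
    have hyl' : (y :: l).Pairwise fun a b => ¬ a < b :=
      hl.sublist ((List.sublist_cons_self z l).cons_cons y)
    rw [slideOut]
    split_ifs with h
    · obtain ⟨h1, h2⟩ := ih hzl h.2 fun x hx v hv w hw =>
        hV x (List.mem_cons_of_mem _ hx) v (List.mem_cons_of_mem _ hv) w
          (List.mem_cons_of_mem _ hw)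
      have hle := slideOut_le V z l
      refine ⟨List.pairwise_cons.2 ⟨fun u hu => hyl u ?_, h1⟩, fun u hu hVu hux => ?_⟩
      · exact (slideOut_perm V z l).mem_iff.1 (List.mem_cons_of_mem _ hu)
      · rcases List.mem_cons.1 hu with rfl | hu
        · exact lt_irrefl _ (hux.trans_le (hle.trans h.1.le))
        · exact h2 u hu hVu hux
    · have hsub : ∀ u, u ∈ y :: l → u ∈ y :: z :: l := fun u hu => by
        simp only [List.mem_cons] at hu ⊢
        tauto
      obtain ⟨h1, h2⟩ := ih hyl' hy fun x hx v hv w hw =>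
        hV x (hsub x hx) v (hsub v hv) w (hsub w hw)
      refine ⟨List.pairwise_cons.2 ⟨fun u hu hzu => ?_, h1⟩, fun u hu hVu hux => ?_⟩
      · have hul := (slideOut_perm V y l).mem_iff.1 (List.mem_cons_of_mem _ hu)
        rcases List.mem_cons.1 hul with rfl | hul
        · have hz : ¬ V z := fun hz => h ⟨hzu, hz⟩
          -- An exchange of `u` with a later `v` would force `z < v` by `hV`, an ascent already
          -- present in the list. Hence `u` is never deposited.
          have : slideOut V u l = (u, l) := slideOut_of_forall_not_lt fun v hv hVv hvu =>
            (List.pairwise_cons.1 hzl).1 v hv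
              (hV u List.mem_cons_self v (by simp [hv]) z (by simp) hy hVv hz hzu hvu)
          rw [this] at hu
          exact (List.pairwise_cons.1 hzl).1 u hu hzu
        · exact (List.pairwise_cons.1 hzl).1 u hul hzu
      · rcases List.mem_cons.1 hu with rfl | hu
        · exact h ⟨hux.trans_le (slideOut_le V y l), hVu⟩
        · exact h2 u hu hVu hux

/-! ### Iterated slides with release times -/

section Rearrange

variable {τ : Type*} [Preorder τ] {U : τ → P → Prop}

theorem GreedyMin.rearrange_spec (hmono : ∀ ⦃s t r⦄, s ≤ t → U s r → U t r)
    (hup : ∀ ⦃t r r'⦄, r < r' → U t r → U t r') {ts : List τ} {l : List P}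
    (h : GreedyMin U ts l) (hts : ts.Pairwise (· ≤ ·)) (hn : l.Nodup) :
    List.Forall₂ U ts (rearrange l) ∧ TopDown (rearrange l) := by
  induction h with
  | nil => simp [rearrange, TopDown]
  | @cons t ts a l ha hmin h ih =>
    obtain ⟨h1, h2⟩ := ih (List.pairwise_cons.1 hts).2 (List.nodup_cons.1 hn).2
    have h3 := slideIn_released hmono hup ha h1 (List.pairwise_cons.1 hts).1
    exact ⟨.cons h3.1 h3.2,
      slideIn_topDown h2 (((rearrange_perm l).cons a).nodup_iff.2 hn)⟩

theorem GreedyMin.rearrange_inj (hmono : ∀ ⦃s t r⦄, s ≤ t → U s r → U t r)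
    (hup : ∀ ⦃t r r'⦄, r < r' → U t r → U t r') {ts : List τ} {l l' : List P}
    (h : GreedyMin U ts l) (h' : GreedyMin U ts l') (hts : ts.Pairwise (· ≤ ·)) (hn : l.Nodup)
    (hn' : l'.Nodup) (he : rearrange l = rearrange l') : l = l' := by
  induction h generalizing l' with
  | nil => cases h'; rfl
  | @cons t ts a l ha hmin h ih =>
    cases h' with
    | @cons _ _ a' l' ha' hmin' h' =>
    have hts' := (List.pairwise_cons.1 hts).2
    have key : ∀ b m, U t b → (∀ c ∈ m, U t c → ¬ c < b) → GreedyMin U ts m → (b :: m).Nodup →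
        slideOut (U t) (slideIn b (rearrange m)).1 (slideIn b (rearrange m)).2 =
          (b, rearrange m) := fun b m hb hm hg hnd =>
      slideOut_slideIn (fun r r' hr => hup hr) hb
        (hg.rearrange_spec hmono hup hts' (List.nodup_cons.1 hnd).2).2
        fun z hz => hm z ((rearrange_perm m).mem_iff.1 hz)
    have e1 := key a l ha hmin h hn
    have e2 := key a' l' ha' hmin' h' hn'
    simp only [rearrange, List.cons.injEq] at he
    rw [he.1, he.2, e2, Prod.mk.injEq] at e1
    rw [e1.1, ih h' hts' (List.nodup_cons.1 hn).2 (List.nodup_cons.1 hn').2 e1.2.symm]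

theorem exists_greedyMin_rearrange_eq (hmono : ∀ ⦃s t r⦄, s ≤ t → U s r → U t r)
    {ts : List τ} {l : List P} (hrel : List.Forall₂ U ts l) (hl : TopDown l)
    (hts : ts.Pairwise (· ≤ ·))
    (hU : ∀ t ∈ ts, ∀ x ∈ l, ∀ v ∈ l, ∀ w ∈ l,
      U t x → U t v → ¬ U t w → w < x → v < x → w < v) :
    ∃ m, GreedyMin U ts m ∧ rearrange m = l := by
  induction ts generalizing l with
  | nil => cases hrel; exact ⟨[], .nil, rfl⟩
  | cons t ts ih =>
    cases hrel with
    | @cons _ y _ l hy hrel =>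
    obtain ⟨htl, hts⟩ := List.pairwise_cons.1 hts
    have h1 := slideOut_released hmono hy hrel htl
    have h2 := slideOut_topDown hl hy (hU t List.mem_cons_self)
    have h3 := slideOut_perm (U t) y l
    have hsub : ∀ u, u ∈ (slideOut (U t) y l).2 → u ∈ y :: l := fun u hu =>
      h3.mem_iff.1 (List.mem_cons_of_mem _ hu)
    obtain ⟨m, hm, hme⟩ := ih h1.2 h2.1 hts fun s hs x hx v hv w hw =>
      hU s (List.mem_cons_of_mem _ hs) x (hsub x hx) v (hsub v hv) w (hsub w hw)
    refine ⟨(slideOut (U t) y l).1 :: m, .cons h1.1 (fun b hb => h2.2 b ?_) hm, ?_⟩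
    · rw [← hme]
      exact (rearrange_perm m).mem_iff.2 hb
    · rw [rearrange, hme, slideIn_slideOut hl]

end Rearrange

end Lists

/-! ### Pattern avoidance in terms of the non-minima -/

section Permutations

variable {P : Type*} [PartialOrder P] {n : ℕ}

theorem avoids_pat123_iff {σ : Fin n ≃ P} :
    Avoids σ pat123 ↔ ∀ i j k, i < j → j < k → σ i < σ j → ¬ σ j < σ k := by
  refine ⟨fun h i j k hij hjk h1 h2 => h ⟨![i, j, k], ?_, ?_⟩, ?_⟩
  · intro s t hst
    fin_cases s <;> fin_cases t <;> simp_all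
    exact hij.trans hjk
  · intro s t hst
    have h3 := h1.trans h2
    fin_cases s <;> fin_cases t <;>
      simp_all [pat123, h1.not_gt, h2.not_gt, h3.not_gt]
  · rintro h ⟨i, hi, hs⟩
    exact h (i 0) (i 1) (i 2) (hi (by decide)) (hi (by decide))
      ((hs 0 1 (by decide)).1.2 (by decide)) ((hs 1 2 (by decide)).1.2 (by decide))

theorem avoids_pat132_iff {σ : Fin n ≃ P} :
    Avoids σ pat132 ↔ ∀ i j k, i < j → j < k → σ i < σ k → ¬ σ k < σ j := by
  refine ⟨fun h i j k hij hjk h1 h2 => h ⟨![i, j, k], ?_, ?_⟩, ?_⟩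
  · intro s t hst
    fin_cases s <;> fin_cases t <;> simp_all
    exact hij.trans hjk
  · intro s t hst
    have h3 := h1.trans h2
    have e0 : pat132 0 = 0 := by decide
    have e1 : pat132 1 = 2 := by decide
    have e2 : pat132 2 = 1 := by decide
    fin_cases s <;> fin_cases t <;>
      simp_all [h1.not_gt, h2.not_gt, h3.not_gt]
  · rintro h ⟨i, hi, hs⟩
    exact h (i 0) (i 1) (i 2) (hi (by decide)) (hi (by decide))
      ((hs 0 2 (by decide)).1.2 (by decide)) ((hs 1 2 (by decide)).2.2 (by decide))

/-- Some entry of `σ` at a position before `t` is smaller than `r`. -/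
def Released (σ : Fin n ≃ P) (t : Fin n) (r : P) : Prop :=
  ∃ j < t, σ j < r

open Classical in
/-- The positions of the entries of `σ` that are not left-to-right minima, in increasing order. -/
noncomputable def nonMin (σ : Fin n ≃ P) : List (Fin n) :=
  (Finset.univ.filter fun i => Released σ i (σ i)).sort (· ≤ ·)

theorem mem_nonMin {σ : Fin n ≃ P} {i : Fin n} : i ∈ nonMin σ ↔ Released σ i (σ i) := by
  simp [nonMin]

theorem nonMin_pairwise_lt (σ : Fin n ≃ P) : (nonMin σ).Pairwise (· < ·) :=
  Finset.sortedLT_sort _ |>.pairwise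

theorem nonMin_pairwise_le (σ : Fin n ≃ P) : (nonMin σ).Pairwise (· ≤ ·) :=
  (nonMin_pairwise_lt σ).imp fun h => h.le

theorem nonMin_nodup (σ : Fin n ≃ P) : (nonMin σ).Nodup :=
  (nonMin_pairwise_lt σ).imp fun h => h.ne

theorem nodup_map_nonMin (σ : Fin n ≃ P) : ((nonMin σ).map σ).Nodup :=
  (nonMin_nodup σ).map σ.injective

theorem Released.mono {σ : Fin n ≃ P} ⦃s t : Fin n⦄ ⦃r : P⦄ (hst : s ≤ t)
    (h : Released σ s r) : Released σ t r :=
  let ⟨j, hj, h⟩ := h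
  ⟨j, hj.trans_le hst, h⟩

theorem Released.trans_lt {σ : Fin n ≃ P} ⦃t : Fin n⦄ ⦃r r' : P⦄ (hr : r < r')
    (h : Released σ t r) : Released σ t r' :=
  let ⟨j, hj, h⟩ := h
  ⟨j, hj, h.trans hr⟩

theorem Released.exists_notMem_nonMin {σ : Fin n ≃ P} {t : Fin n} {r : P}
    (h : Released σ t r) : ∃ j < t, j ∉ nonMin σ ∧ σ j < r := by
  obtain ⟨j, ⟨hj, hr⟩, hmin⟩ := WellFounded.has_min (wellFounded_lt (α := Fin n))
    {j | j < t ∧ σ j < r} h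
  refine ⟨j, hj, fun hm => ?_, hr⟩
  obtain ⟨k, hk, hkj⟩ := mem_nonMin.1 hm
  exact hmin k ⟨hk.trans hj, hkj.trans hr⟩ hk

theorem forall₂_map_right_self_iff {α β : Type*} {σ : α → β} {U : α → β → Prop} {ts : List α} :
    List.Forall₂ U ts (ts.map σ) ↔ ∀ i ∈ ts, U i (σ i) := by
  rw [List.forall₂_map_right_iff, List.forall₂_same]

/-- If two permutations agree outside the positions of the entries of `σ` that are not
left-to-right minima and the remaining entries of `σ'` are placed after their release, then both
have the same left-to-right minima, at the same positions. -/
theorem released_eq_and_nonMin_eq {σ σ' : Fin n ≃ P} (hag : ∀ i ∉ nonMin σ, σ' i = σ i)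
    (hrel : ∀ i ∈ nonMin σ, Released σ i (σ' i)) :
    Released σ' = Released σ ∧ nonMin σ' = nonMin σ := by
  have hR : Released σ' = Released σ := by
    ext t r
    constructor
    · rintro ⟨j, hj, hr⟩
      by_cases hm : j ∈ nonMin σ
      · exact ((hrel j hm).trans_lt hr).mono hj.le
      · exact ⟨j, hj, hag j hm ▸ hr⟩
    · intro h
      obtain ⟨j, hj, hm, hr⟩ := h.exists_notMem_nonMin
      exact ⟨j, hj, (hag j hm).symm ▸ hr⟩
  refine ⟨hR, ?_⟩
  have : ∀ i, Released σ' i (σ' i) ↔ Released σ i (σ i) := fun i => by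
    rw [hR]
    by_cases hm : i ∈ nonMin σ
    · exact iff_of_true (hrel i hm) (mem_nonMin.1 hm)
    · rw [hag i hm]
  unfold nonMin
  congr 1
  ext i
  simp [this]

/-- The last two entries of a 123 are non-minima. Conversely, an ascent of non-minima extends to the
left by an entry below its first term. -/
theorem avoids_pat123_iff_topDown {σ : Fin n ≃ P} :
    Avoids σ pat123 ↔ TopDown ((nonMin σ).map σ) := by
  rw [avoids_pat123_iff, TopDown, List.pairwise_map]
  constructor
  · intro h
    refine (nonMin_pairwise_lt σ).imp_of_mem fun {j k} hj _ hjk hlt => ?_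
    obtain ⟨i, hi, hij⟩ := mem_nonMin.1 hj
    exact h i j k hi hjk hij hlt
  · intro h i j k hij hjk h1 h2
    have hj : j ∈ nonMin σ := mem_nonMin.2 ⟨i, hij, h1⟩
    have hk : k ∈ nonMin σ := mem_nonMin.2 ⟨j, hjk, h2⟩
    have := (List.pairwise_iff_getElem.1 ((nonMin_pairwise_lt σ).and h))
    obtain ⟨p, hp, rfl⟩ := List.mem_iff_getElem.1 hj
    obtain ⟨q, hq, rfl⟩ := List.mem_iff_getElem.1 hk
    rcases lt_trichotomy p q with hpq | rfl | hpq
    · exact (this p q hp hq hpq).2 h2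
    · exact lt_irrefl _ hjk
    · exact lt_asymm hjk (this q p hq hp hpq).1

theorem greedyMin_map_iff {σ : Fin n ≃ P} {U : Fin n → P → Prop} {ts : List (Fin n)}
    (hts : ts.Pairwise (· < ·)) :
    GreedyMin U ts (ts.map σ) ↔ (∀ i ∈ ts, U i (σ i)) ∧
      ∀ i ∈ ts, ∀ j ∈ ts, i < j → U i (σ j) → ¬ σ j < σ i := by
  induction ts with
  | nil => exact iff_of_true .nil (by simp)
  | cons t ts ih =>
    obtain ⟨ht, hts⟩ := List.pairwise_cons.1 hts
    constructor
    · intro h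
      cases h with
      | cons ha hmin h =>
      obtain ⟨h1, h2⟩ := (ih hts).1 h
      refine ⟨List.forall_mem_cons.2 ⟨ha, h1⟩, fun i hi j hj hij => ?_⟩
      rcases List.mem_cons.1 hi with rfl | hi' <;> rcases List.mem_cons.1 hj with rfl | hj'
      · exact absurd hij (lt_irrefl _)
      · exact hmin _ (List.mem_map_of_mem hj')
      · exact absurd hij (ht i hi').not_gt
      · exact h2 i hi' j hj' hij
    · rintro ⟨h1, h2⟩
      refine .cons (h1 t List.mem_cons_self) (fun b hb => ?_) ((ih hts).2
        ⟨fun i hi => h1 i (List.mem_cons_of_mem _ hi), fun i hi j hj =>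
          h2 i (List.mem_cons_of_mem _ hi) j (List.mem_cons_of_mem _ hj)⟩)
      obtain ⟨j, hj, rfl⟩ := List.mem_map.1 hb
      exact h2 t List.mem_cons_self j (List.mem_cons_of_mem _ hj) (ht j hj)

/-- In an occurrence of 132, the first entry is what releases the last one before the position of
the middle one. -/
theorem avoids_pat132_iff_greedyMin {σ : Fin n ≃ P} :
    Avoids σ pat132 ↔ GreedyMin (Released σ) (nonMin σ) ((nonMin σ).map σ) := by
  rw [avoids_pat132_iff, greedyMin_map_iff (nonMin_pairwise_lt σ)]
  constructor
  · rintro h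
    refine ⟨fun i hi => mem_nonMin.1 hi, fun j _ k _ hjk ⟨i, hi, hik⟩ => h i j k hi hjk hik⟩
  · rintro ⟨-, h⟩ i j k hij hjk h1 h2
    exact h j (mem_nonMin.2 ⟨i, hij, h1.trans h2⟩) k (mem_nonMin.2 ⟨i, hij.trans hjk, h1⟩) hjk
      ⟨i, hij, h1⟩ h2

/-- The entries of a permutation at given positions can be permuted. -/
theorem exists_equiv_map_eq {β : Type*} (σ : Fin n ≃ β) {ts : List (Fin n)} (hts : ts.Nodup)
    {l : List β}
    (hl : l.Perm (ts.map σ)) :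
    ∃ σ' : Fin n ≃ β, (∀ i ∉ ts, σ' i = σ i) ∧ ts.map σ' = l := by
  classical
  have hlen : l.length = ts.length := by simpa using hl.length_eq
  have hnd : l.Nodup := hl.nodup_iff.2 (hts.map σ.injective)
  let e : Fin n → β := fun i =>
    if h : i ∈ ts then l[ts.idxOf i]'(hlen ▸ List.idxOf_lt_length_iff.2 h) else σ i
  have he1 : ∀ i (h : i ∈ ts), e i = l[ts.idxOf i]'(hlen ▸ List.idxOf_lt_length_iff.2 h) :=
    fun i h => dif_pos h
  have he2 : ∀ i ∉ ts, e i = σ i := fun i h => dif_neg h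
  have hne : ∀ i ∈ ts, ∀ j ∉ ts, e i ≠ e j := fun i hi j hj hij => by
    rw [he1 i hi, he2 j hj] at hij
    obtain ⟨k, hk, hkj⟩ := List.mem_map.1 (hl.mem_iff.1 (hij ▸ List.getElem_mem _))
    exact hj (σ.injective hkj ▸ hk)
  have hinj : Function.Injective e := fun i j hij => by
    by_cases hi : i ∈ ts <;> by_cases hj : j ∈ ts
    · rw [he1 i hi, he1 j hj, hnd.getElem_inj_iff] at hij
      exact (List.idxOf_inj hi).1 hij
    · exact absurd hij (hne i hi j hj)
    · exact absurd hij.symm (hne j hj i hi)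
    · rw [he2 i hi, he2 j hj] at hij
      exact σ.injective hij
  have := Finite.of_equiv _ σ
  have hbij : Function.Bijective e :=
    hinj.bijective_of_nat_card_le (Nat.card_congr σ).ge
  refine ⟨Equiv.ofBijective e hbij, he2, List.ext_getElem (by simp [hlen]) fun k h1 h2 => ?_⟩
  have hk : k < ts.length := hlen ▸ h2
  rw [List.getElem_map, Equiv.ofBijective_apply, he1 _ (List.getElem_mem hk)]
  simp only [hts.idxOf_getElem]

/-! ### The injection and its image -/

/-- `σ'` arises from `σ` by rearranging the entries that are not left-to-right minima. -/
def IsRearrangement (σ σ' : Fin n ≃ P) : Prop :=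
  (∀ i ∉ nonMin σ, σ' i = σ i) ∧ (nonMin σ).map σ' = rearrange ((nonMin σ).map σ)

theorem exists_isRearrangement (σ : Fin n ≃ P) : ∃ σ', IsRearrangement σ σ' :=
  exists_equiv_map_eq σ (nonMin_nodup σ) (rearrange_perm _)

theorem IsRearrangement.spec {σ σ' : Fin n ≃ P} (h : IsRearrangement σ σ')
    (hσ : Avoids σ pat132) : Released σ' = Released σ ∧ nonMin σ' = nonMin σ ∧
      Avoids σ' pat123 := by
  obtain ⟨h1, h2⟩ := (avoids_pat132_iff_greedyMin.1 hσ).rearrange_spec Released.mono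
    Released.trans_lt (nonMin_pairwise_le σ) (nodup_map_nonMin σ)
  rw [← h.2] at h1 h2
  obtain ⟨h3, h4⟩ := released_eq_and_nonMin_eq h.1 (forall₂_map_right_self_iff.1 h1)
  exact ⟨h3, h4, avoids_pat123_iff_topDown.2 (h4 ▸ h2)⟩

/-- The image retains the release relation and the non-minimal positions, which is all the inverse
slides use. -/
theorem IsRearrangement.inj {σ₁ σ₂ σ' : Fin n ≃ P} (h₁ : IsRearrangement σ₁ σ')
    (h₂ : IsRearrangement σ₂ σ') (hσ₁ : Avoids σ₁ pat132) (hσ₂ : Avoids σ₂ pat132) :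
    σ₁ = σ₂ := by
  obtain ⟨r1, n1, -⟩ := h₁.spec hσ₁
  obtain ⟨r2, n2, -⟩ := h₂.spec hσ₂
  have hr := r1.symm.trans r2
  have hn := n1.symm.trans n2
  have g1 := avoids_pat132_iff_greedyMin.1 hσ₁
  have g2 := avoids_pat132_iff_greedyMin.1 hσ₂
  have e := h₁.2.symm.trans ((congrArg (fun t => t.map σ') hn).trans h₂.2)
  rw [← hr, ← hn] at g2
  rw [← hn] at e
  have hmap := g1.rearrange_inj Released.mono Released.trans_lt g2 (nonMin_pairwise_le σ₁)
    (nodup_map_nonMin σ₁) ((nonMin_nodup σ₁).map σ₂.injective) e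
  ext i
  by_cases hi : i ∈ nonMin σ₁
  · exact List.map_inj_left.1 hmap i hi
  · rw [← h₁.1 i hi, h₂.1 i (hn ▸ hi)]

/-- The configuration that makes `Av_P(132)` and `Av_P(123)` differ. -/
def HasConfiguration (P : Type*) [PartialOrder P] : Prop :=
  ∃ a b c d e : P, d < a ∧ a < c ∧ e < b ∧ b < c ∧ ¬ d < b ∧ ¬ b < a

theorem exists_isRearrangement_of_avoids (hP : ¬ HasConfiguration P) {σ' : Fin n ≃ P}
    (h : Avoids σ' pat123) : ∃ σ, Avoids σ pat132 ∧ IsRearrangement σ σ' := by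
  obtain ⟨m, hm, hme⟩ := exists_greedyMin_rearrange_eq (U := Released σ') Released.mono
    (forall₂_map_right_self_iff.2 fun i hi => mem_nonMin.1 hi) (avoids_pat123_iff_topDown.1 h)
    (nonMin_pairwise_le σ') fun t _ x _ v _ w hw _ ⟨d, hd, hdv⟩ hnw hwx hvx => by
      obtain ⟨i, hi, rfl⟩ := List.mem_map.1 hw
      obtain ⟨e, -, he⟩ := mem_nonMin.1 hi
      by_contra hwv
      -- `σ' d` releases `v` in time but is not below `w = σ' i`; `σ' e` shows that `w` is a
      -- non-minimum.
      exact hP ⟨v, σ' i, x, σ' d, σ' e, hdv, hvx, he, hwx, fun h => hnw ⟨d, hd, h⟩, hwv⟩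
  obtain ⟨σ, hag, hmap⟩ := exists_equiv_map_eq σ' (nonMin_nodup σ')
    ((rearrange_perm m).symm.trans (by rw [hme]))
  have hg := hm
  rw [← hmap, greedyMin_map_iff (nonMin_pairwise_lt σ')] at hg
  obtain ⟨h1, h2⟩ := released_eq_and_nonMin_eq hag hg.1
  refine ⟨σ, avoids_pat132_iff_greedyMin.2 ?_, fun i hi => (hag i (h2 ▸ hi)).symm, ?_⟩
  · rwa [h1, h2, hmap]
  · rw [h2, hmap, hme]

theorem exists_injective_rearrangement (P : Type*) [PartialOrder P] (n : ℕ) :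
    ∃ f : {σ : Fin n ≃ P // Avoids σ pat132} → {σ : Fin n ≃ P // Avoids σ pat123},
      Function.Injective f ∧ ∀ σ, IsRearrangement σ.1 (f σ).1 := by
  choose g hg using exists_isRearrangement (P := P) (n := n)
  refine ⟨fun σ => ⟨g σ.1, ((hg σ.1).spec σ.2).2.2⟩, fun σ₁ σ₂ h => Subtype.ext ?_,
    fun σ => hg σ.1⟩
  have h : g σ₁.1 = g σ₂.1 := Subtype.ext_iff.1 h
  exact (hg σ₁.1).inj (h ▸ hg σ₂.1) σ₁.2 σ₂.2

theorem av_le_av (P : Type*) [PartialOrder P] [Finite P] : Av P pat132 ≤ Av P pat123 :=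
  let ⟨_, hf, _⟩ := exists_injective_rearrangement P (Nat.card P)
  Nat.card_le_card_of_injective _ hf

theorem av_lt_av_iff_exists (P : Type*) [PartialOrder P] [Finite P] :
    Av P pat132 < Av P pat123 ↔ ∃ σ' : Fin (Nat.card P) ≃ P, Avoids σ' pat123 ∧
      ∀ σ, Avoids σ pat132 → ¬ IsRearrangement σ σ' := by
  obtain ⟨f, hf, hr⟩ := exists_injective_rearrangement P (Nat.card P)
  rw [← not_iff_not, not_lt]
  constructor
  · rintro h ⟨σ', h', hσ'⟩
    obtain ⟨σ, hσ⟩ := (hf.bijective_of_nat_card_le h).2 ⟨σ', h'⟩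
    exact hσ' σ.1 σ.2 (by simpa [hσ] using hr σ)
  · intro h
    push Not at h
    refine Nat.card_le_card_of_surjective f fun σ' => ?_
    obtain ⟨σ, hσ, hσ'⟩ := h σ'.1 σ'.2
    refine ⟨⟨σ, hσ⟩, Subtype.ext (Equiv.ext fun i => ?_)⟩
    have h2 := hr ⟨σ, hσ⟩
    by_cases hi : i ∈ nonMin σ
    · exact List.map_inj_left.1 (h2.2.trans hσ'.2.symm) i hi
    · rw [h2.1 i hi, hσ'.1 i hi]

theorem hasConfiguration_of_av_lt_av [Finite P] (h : Av P pat132 < Av P pat123) :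
    HasConfiguration P := by
  obtain ⟨σ', h1, h2⟩ := (av_lt_av_iff_exists P).1 h
  by_contra hP
  obtain ⟨σ, hσ, hσ'⟩ := exists_isRearrangement_of_avoids hP h1
  exact h2 σ hσ hσ'

end Permutations

/-! ### The configuration as induced subposets, and strictness -/

section Configuration

/-- All relations are forced except how `e` compares with `d` and `a`; `d ≤ e` would give `d < b`.
The cases `e < d`, only `e < a`, and neither give `Q₃`, `Q₂`, `Q₁`. -/
theorem hasConfiguration_iff (P : Type*) [PartialOrder P] :
    HasConfiguration P ↔ HasInduced P Q₁ ∨ HasInduced P Q₂ ∨ HasInduced P Q₃ := by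
  constructor
  · rintro ⟨a, b, c, d, e, hda, hac, heb, hbc, hdb, hba⟩
    have hdc := hda.trans hac
    have hec := heb.trans hbc
    have hab : ¬ a ≤ b := fun h => hdb (hda.trans_le h)
    have hba' : ¬ b ≤ a := fun h => hba (h.lt_of_ne fun h => hab h.ge)
    have hbd : ¬ b ≤ d := fun h => hba' (h.trans hda.le)
    have hde : ¬ d ≤ e := fun h => hdb (h.trans_lt heb)
    have hdb' : ¬ d ≤ b := fun h => hdb (h.lt_of_ne fun h => hbd h.ge)
    have hae : ¬ a ≤ e := fun h => hab (h.trans heb.le)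
    have hca := hac.not_ge
    have hcb := hbc.not_ge
    have hcd := hdc.not_ge
    have hce := hec.not_ge
    have had := hda.not_ge
    have hbe := heb.not_ge
    let f : Five → P := fun x => Five.rec a b c d e x
    by_cases hed : e < d
    · have hea := hed.trans hda
      refine .inr (.inr ⟨OrderEmbedding.ofMapLEIff (α := Q₃) f ?_⟩)
      have : ∀ x y : Five, f x ≤ f y ↔ (x = y ∨ (x, y) ∈ lt₃) := by
        rintro (_ | _) (_ | _) <;>
          simp [f, lt₃, hda.le, hac.le, heb.le, hbc.le, hdc.le, hec.le, hed.le, hea.le, *]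
      exact this
    have hed : ¬ e ≤ d := fun h => hed (h.lt_of_ne fun h => hde h.ge)
    by_cases hea : e < a
    · refine .inr (.inl ⟨OrderEmbedding.ofMapLEIff (α := Q₂) f ?_⟩)
      have : ∀ x y : Five, f x ≤ f y ↔ (x = y ∨ (x, y) ∈ lt₂) := by
        rintro (_ | _) (_ | _) <;>
          simp [f, lt₂, hda.le, hac.le, heb.le, hbc.le, hdc.le, hec.le, hea.le, *]
      exact this
    · have hea : ¬ e ≤ a := fun h => hea (h.lt_of_ne fun h => hae h.ge)
      refine .inl ⟨OrderEmbedding.ofMapLEIff (α := Q₁) f ?_⟩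
      have : ∀ x y : Five, f x ≤ f y ↔ (x = y ∨ (x, y) ∈ lt₁) := by
        rintro (_ | _) (_ | _) <;>
          simp [f, lt₁, hda.le, hac.le, heb.le, hbc.le, hdc.le, hec.le, *]
      exact this
  · have key : ∀ {Q : Type} [PartialOrder Q], HasConfiguration Q → HasInduced P Q →
        HasConfiguration P := by
      rintro Q _ ⟨a, b, c, d, e, h⟩ ⟨f⟩
      exact ⟨f a, f b, f c, f d, f e, by simpa only [f.lt_iff_lt] using h⟩
    rintro (h | h | h)
    · have hlt : ∀ x y : Five, @LT.lt Q₁ _ x y ↔ (x, y) ∈ lt₁ := fun x y => by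
        have : ∀ x y : Five, ((x = y ∨ (x, y) ∈ lt₁) ∧ ¬ (y = x ∨ (y, x) ∈ lt₁)) ↔
          (x, y) ∈ lt₁ := by decide
        exact lt_iff_le_not_ge.trans (this x y)
      exact key (Q := Q₁) ⟨Five.a, Five.b, Five.c, Five.d, Five.e,
        (hlt _ _).2 (by decide), (hlt _ _).2 (by decide), (hlt _ _).2 (by decide),
        (hlt _ _).2 (by decide), mt (hlt _ _).1 (by decide), mt (hlt _ _).1 (by decide)⟩ h
    · have hlt : ∀ x y : Five, @LT.lt Q₂ _ x y ↔ (x, y) ∈ lt₂ := fun x y => by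
        have : ∀ x y : Five, ((x = y ∨ (x, y) ∈ lt₂) ∧ ¬ (y = x ∨ (y, x) ∈ lt₂)) ↔
          (x, y) ∈ lt₂ := by decide
        exact lt_iff_le_not_ge.trans (this x y)
      exact key (Q := Q₂) ⟨Five.a, Five.b, Five.c, Five.d, Five.e,
        (hlt _ _).2 (by decide), (hlt _ _).2 (by decide), (hlt _ _).2 (by decide),
        (hlt _ _).2 (by decide), mt (hlt _ _).1 (by decide), mt (hlt _ _).1 (by decide)⟩ h
    · have hlt : ∀ x y : Five, @LT.lt Q₃ _ x y ↔ (x, y) ∈ lt₃ := fun x y => by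
        have : ∀ x y : Five, ((x = y ∨ (x, y) ∈ lt₃) ∧ ¬ (y = x ∨ (y, x) ∈ lt₃)) ↔
          (x, y) ∈ lt₃ := by decide
        exact lt_iff_le_not_ge.trans (this x y)
      exact key (Q := Q₃) ⟨Five.a, Five.b, Five.c, Five.d, Five.e,
        (hlt _ _).2 (by decide), (hlt _ _).2 (by decide), (hlt _ _).2 (by decide),
        (hlt _ _).2 (by decide), mt (hlt _ _).1 (by decide), mt (hlt _ _).1 (by decide)⟩ h

/-- A finite type can be listed in the order given by an injective rank function. -/
theorem exists_equiv_strictMono {P α : Type*} [Finite P] [LinearOrder α] {g : P → α}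
    (hg : Function.Injective g) :
    ∃ σ : Fin (Nat.card P) ≃ P, ∀ i j, i < j ↔ g (σ i) < g (σ j) := by
  let := Fintype.ofFinite P
  let : LinearOrder P := LinearOrder.lift' g hg
  let e := Fintype.orderIsoFinOfCardEq P (Nat.card_eq_fintype_card (α := P)).symm
  exact ⟨e.toEquiv, fun i j => e.lt_iff_lt.symm⟩

open Classical in
/-- The phase in which an element is listed in the permutation witnessing strictness. -/
noncomputable def phase {P : Type*} [PartialOrder P] (a b c p : P) : ℕ :=
  if p = a then 4 else if p = b then 3 else if p = c then 1 else if p < b then 2 else 0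

/-- A 132-avoiding preimage would have to place `a` first (`b` is not yet released and `c` is not
minimal), then `b`, then `c`. -/
theorem not_isRearrangement_of_map_eq {P : Type*} [PartialOrder P] {n : ℕ} {a b c : P}
    (hac : a < c) (hbc : b < c) (hba : ¬ b < a) (hab : ¬ a < b) (hne : a ≠ b) {σ' : Fin n ≃ P}
    (hmap : (nonMin σ').map σ' = [c, b, a])
    (ha : Released σ' (σ'.symm c) a) (hb : ¬ Released σ' (σ'.symm c) b)
    {σ : Fin n ≃ P} (hσ : Avoids σ pat132) : ¬ IsRearrangement σ σ' := by
  intro h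
  obtain ⟨h1, h2, -⟩ := h.spec hσ
  have hg := avoids_pat132_iff_greedyMin.1 hσ
  have he := h.2
  have hp := rearrange_perm ((nonMin σ).map σ)
  rw [← h1, ← h2] at hg
  rw [← h2, hmap] at he
  rw [← h2, ← he] at hp
  have hts : nonMin σ' = [σ'.symm c, σ'.symm b, σ'.symm a] := by
    have := congrArg (List.map σ'.symm) hmap
    simpa using this
  rw [hts] at he hg hp
  simp only [List.map_cons, List.map_nil] at he hg hp
  generalize σ (σ'.symm c) = p at *
  generalize σ (σ'.symm b) = q at *
  generalize σ (σ'.symm a) = r at *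
  cases hg with
  | cons hp1 hp2 hg =>
  cases hg with
  | cons hq1 hq2 hg =>
  cases hg with
  | cons hr1 hr2 hg =>
  have hb' : Released σ' (σ'.symm b) b := by
    have : σ'.symm b ∈ nonMin σ' := by simp [hts]
    simpa using mem_nonMin.1 this
  have hnd : [c, b, a].Nodup := by simp [hne.symm, hac.ne', hbc.ne']
  have hnd' := hp.nodup_iff.1 hnd
  have hmem : ∀ x, (x = p ∨ x = q ∨ x = r) ↔ (x = c ∨ x = b ∨ x = a) := fun x => by
    simpa using hp.mem_iff.symm
  have hpa : p = a := by
    rcases (hmem p).1 (by simp) with rfl | rfl | h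
    · refine absurd hac (hp2 a ?_ ha)
      have := (hmem a).2 (by simp)
      simpa [hac.ne] using this
    · exact absurd hp1 hb
    · exact h
  subst hpa
  have hqb : q = b := by
    rcases (hmem q).1 (by simp) with rfl | h | rfl
    · refine absurd hbc (hq2 b ?_ hb')
      have := (hmem b).2 (by simp)
      simpa [hbc.ne, hne.symm] using this
    · exact h
    · simp at hnd'
  subst hqb
  have hrc : r = c := by
    rcases (hmem r).1 (by simp) with h | rfl | rfl
    · exact h
    · simp at hnd'
    · simp at hnd'
  subst hrc
  -- The list `[a, b, c]` rearranges to `[c, a, b]`, not to `[c, b, a]`.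
  simp [rearrange, slideIn, hac, hbc, hab, hne.symm] at he

theorem HasConfiguration.exists_not_isRearrangement {P : Type*} [PartialOrder P] [Finite P]
    (h : HasConfiguration P) : ∃ σ' : Fin (Nat.card P) ≃ P, Avoids σ' pat123 ∧
      ∀ σ, Avoids σ pat132 → ¬ IsRearrangement σ σ' := by
  obtain ⟨a, b, c, d, e, hda, hac, heb, hbc, hdb, hba⟩ := h
  have hab : ¬ a < b := fun h => hdb (hda.trans h)
  have hne : a ≠ b := fun h => hdb (h ▸ hda)
  have pa : phase a b c a = 4 := by simp [phase]
  have pb : phase a b c b = 3 := by simp [phase, hne.symm]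
  have pc : phase a b c c = 1 := by simp [phase, hac.ne', hbc.ne']
  have pd : phase a b c d = 0 := by
    simp [phase, hda.ne, (hda.trans hac).ne, hdb]
    rintro rfl
    exact hba hda
  have p2 : ∀ x, x < b → phase a b c x = 2 := fun x hx => by
    simp [phase, hx, hx.ne, (hx.trans hbc).ne]
    rintro rfl
    exact hab hx
  have p0 : ∀ x, x ≠ a → x ≠ b → x ≠ c → ¬ x < b → phase a b c x = 0 := fun x h1 h2 h3 h4 => by
    simp [phase, *]
  -- The reversed linear extension rules out ascents within a phase.
  let g : P → ℕ ×ₗ (LinearExtension P)ᵒᵈ := fun x =>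
    toLex (phase a b c x, OrderDual.toDual (toLinearExtension x))
  have hg : Function.Injective g := fun x y hxy => by
    have := congrArg (fun z => (ofLex z).2) hxy
    exact this
  obtain ⟨σ', hσ'⟩ := exists_equiv_strictMono hg
  have hrel : ∀ u v, Released σ' (σ'.symm u) v ↔ ∃ w, g w < g u ∧ w < v := fun u v => by
    constructor
    · rintro ⟨j, hj, hv⟩
      exact ⟨σ' j, by simpa using (hσ' _ _).1 hj, hv⟩
    · rintro ⟨w, hw, hv⟩
      exact ⟨σ'.symm w, (hσ' _ _).2 (by simpa using hw), by simpa using hv⟩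
  have hlt : ∀ {u v}, phase a b c u < phase a b c v → g u < g v := fun h =>
    Prod.Lex.toLex_lt_toLex.2 (.inl h)
  have hle : ∀ {u v}, g u < g v → phase a b c u ≤ phase a b c v := fun h =>
    (Prod.Lex.toLex_lt_toLex.1 h).elim (fun h => h.le) fun h => h.1.le
  have hdown : ∀ {u v}, g u < g v → u < v → phase a b c u < phase a b c v := fun h huv => by
    refine (Prod.Lex.toLex_lt_toLex.1 h).resolve_right fun h' => ?_
    exact (OrderDual.toDual_lt_toDual.1 h'.2).not_ge (toLinearExtension.monotone huv.le)
  have hcb' : σ'.symm c < σ'.symm b := (hσ' _ _).2 (by simpa using hlt (by omega))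
  have hba' : σ'.symm b < σ'.symm a := (hσ' _ _).2 (by simpa using hlt (by omega))
  have hts : nonMin σ' = [σ'.symm c, σ'.symm b, σ'.symm a] := by
    refine List.Perm.eq_of_pairwise (le := (· < ·)) (fun x y _ _ h1 h2 => absurd h1 h2.not_gt)
      (nonMin_pairwise_lt σ') (by simp [hcb', hba', hcb'.trans hba']) ?_
    refine (List.perm_ext_iff_of_nodup (nonMin_nodup σ') (by
      simp [hne.symm, hac.ne', hbc.ne'])).2 fun i => ?_
    obtain ⟨x, rfl⟩ := σ'.symm.surjective i
    rw [mem_nonMin, Equiv.apply_symm_apply, hrel]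
    simp only [List.mem_cons, EmbeddingLike.apply_eq_iff_eq, List.not_mem_nil, or_false]
    constructor
    -- Anything below an element of phase 2 is again below `b`, hence in phase 2, and nothing
    -- precedes phase 0; so only `c`, `b`, `a` can be non-minima.
    · rintro ⟨w, hw, hwx⟩
      by_contra! hx
      have h1 := hdown hw hwx
      by_cases hxb : x < b
      · rw [p2 x hxb, p2 w (hwx.trans hxb)] at h1
        exact lt_irrefl _ h1
      · rw [p0 x hx.2.2 hx.2.1 hx.1 hxb] at h1
        exact Nat.not_lt_zero _ h1
    · rintro (rfl | rfl | rfl)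
      · exact ⟨d, hlt (by omega), hda.trans hac⟩
      · exact ⟨e, hlt (by rw [p2 e heb, pb]; omega), heb⟩
      · exact ⟨d, hlt (by omega), hda⟩
  have hmap : (nonMin σ').map σ' = [c, b, a] := by simp [hts]
  refine ⟨σ', avoids_pat123_iff_topDown.2 ?_, fun σ =>
    not_isRearrangement_of_map_eq hac hbc hba hab hne hmap
      ((hrel c a).2 ⟨d, hlt (by omega), hda⟩) fun h => ?_⟩
  · rw [hmap]
    simp [TopDown, hac.not_gt, hbc.not_gt, hba]
  · obtain ⟨w, hw, hwb⟩ := (hrel c b).1 h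
    have := hle hw
    rw [p2 w hwb, pc] at this
    omega

end Configuration

end PosetPerm

theorem mainTheorem1 (P : Type*) [PartialOrder P] [Finite P] :
    PosetPerm.Av P PosetPerm.pat132 ≤ PosetPerm.Av P PosetPerm.pat123 ∧
      (PosetPerm.Av P PosetPerm.pat132 < PosetPerm.Av P PosetPerm.pat123 ↔
        PosetPerm.HasInduced P PosetPerm.Q₁ ∨ PosetPerm.HasInduced P PosetPerm.Q₂ ∨
          PosetPerm.HasInduced P PosetPerm.Q₃) := by
  refine ⟨PosetPerm.av_le_av P, ?_⟩
  rw [← PosetPerm.hasConfiguration_iff]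
  exact ⟨PosetPerm.hasConfiguration_of_av_lt_av,
    fun h => (PosetPerm.av_lt_av_iff_exists P).2 h.exists_not_isRearrangement⟩
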